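/- Let $X=(x_1,\dots,x_n)$ be a finite nonempty family of points of $\mathbb{R}^d$ (several data points may share a location). For a nonempty finite set $C\subset\mathbb{R}^d$ let $\Phi(X,C)=\sum_{i=1}^n\min_{c\in C}\|x_i-c\|^2$, and let $\mathrm{OPT}_k(X)=\inf\{\Phi(X,C): C\subset\mathbb{R}^d,\ |C|=k\}$ (for $d=0$ this is read as $0$). Let $\varepsilon_1\in[0,1)$, $\varepsilon_2\ge 0$ and let $k\ge 2$ be an integer. Noisy $k$-means++ chooses $k$ data points as centers one after the other. In each iteration let $p$ be the distribution on the data points that exact $k$-means++ would use: the uniform distribution in the first iteration, and $p(x_i)=\min_{c\in C}\|x_i-c\|^2/\Phi(X,C)$ in later iterations, where $C\ne\emptyset$ is the current set of centers. An adversary, who may take all previous random choices into account, picks an arbitrary probability distribution $q$ on the data points with $(1-\varepsilon_1)\,p(x_i)\le q(x_i)\le(1+\varepsilon_2)\,p(x_i)$ for all $i$, and the next center is sampled from $q$. (If $\Phi(X,C)=0$, then $p$ is undefined and $q$ may be any distribution on the data points; the cost stays $0$.) Let $T_k$ be the set of the $k$ sampled centers. There is an absolute constant $A>0$ such that for all $d,n,k,X,\varepsilon_1,\varepsilon_2$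 as above and for every such adversary the following holds, where $M=\max\bigl\{18,\ \tfrac{24(\varepsilon_1+\varepsilon_2)(1+\varepsilon_2)}{(1-\varepsilon_1)^2}\bigr\}$. 1. If $\frac{k}{\ln k}\ge M$, then $$\mathbb{E}[\Phi(X,T_k)]\le A\left(\frac{1+\varepsilon_2}{1-\varepsilon_1}\right)^3\ln^2(k)\cdot\mathrm{OPT}_k(X).$$ 2. If $\frac{k}{\ln k}\le M$, then $$\mathbb{E}[\Phi(X,T_k)]\le A\left(\frac{1+\varepsilon_2}{1-\varepsilon_1}\right)^4\max\left\{1,\ \ln\frac{1+\varepsilon_2}{1-\varepsilon_1}\right\}^2\cdot\mathrm{OPT}_k(X).$$ -/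

import Mathlib

namespace NoisyKMeans

/-- Euclidean space of dimension `d`. -/
abbrev Pt (d : ℕ) : Type := EuclideanSpace ℝ (Fin d)

/-- `min_{c ∈ C} ‖y - c‖²`, the squared distance of `y` to the closest center; it is only used for
nonempty finite `C`, where the infimum is a minimum. -/
noncomputable def sqDist {d : ℕ} (y : Pt d) (C : Set (Pt d)) : ℝ :=
  ⨅ c : C, ‖y - (c : Pt d)‖ ^ 2

/-- The `k`-means cost `Φ(X, C)` of the data set `X = (x i)_{i}` (a finite family of points, so that
a location may carry several data points) with respect to the center set `C`. -/
noncomputable def cost {d : ℕ} {ι : Type*} [Fintype ι] (x : ι → Pt d) (C : Set (Pt d)) : ℝ :=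
  ∑ i, sqDist (x i) C

/-- The optimal `k`-means cost `OPT_k(X)`: the infimum of `Φ(X, C)` over all center sets `C` of
exactly `k` points of the ambient space. -/
noncomputable def opt {d : ℕ} {ι : Type*} [Fintype ι] (x : ι → Pt d) (k : ℕ) : ℝ :=
  ⨅ C : {C : Finset (Pt d) // C.card = k}, cost x (C.1 : Set (Pt d))

/-- The set of centers determined by a sequence of chosen data points. -/
def centers {d : ℕ} {ι : Type*} (x : ι → Pt d) {t : ℕ} (h : Fin t → ι) : Set (Pt d) :=
  Set.range fun s => x (h s)

/-- The distribution used by exact `k`-means++ after the data points `h 0, …, h (t - 1)` have been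
chosen: uniform for the first center, `D²`-sampling afterwards. -/
noncomputable def seedProb {d : ℕ} {ι : Type*} [Fintype ι] (x : ι → Pt d) {t : ℕ}
    (h : Fin t → ι) (i : ι) : ℝ :=
  if t = 0 then 1 / (Fintype.card ι : ℝ)
  else sqDist (x i) (centers x h) / cost x (centers x h)

/-- A strategy of the adversary: in every iteration, depending on all the choices made so far,
a probability distribution on the data points. -/
abbrev Strategy (ι : Type*) : Type _ := (t : ℕ) → (Fin t → ι) → PMF ι

/-- The strategy `q` is admissible for the noise parameters `ε₁, ε₂`: every probability deviates
from that of exact `k`-means++ by a factor in `[1 - ε₁, 1 + ε₂]`. If the current cost is already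
zero, then `D²`-sampling is undefined and `q` may be any distribution on the data points (further
centers do not change the cost). -/
def IsNoisy {d : ℕ} {ι : Type*} [Fintype ι] (x : ι → Pt d) (ε₁ ε₂ : ℝ) (q : Strategy ι) : Prop :=
  ∀ (t : ℕ) (h : Fin t → ι), (t = 0 ∨ 0 < cost x (centers x h)) → ∀ i : ι,
    (1 - ε₁) * seedProb x h i ≤ (q t h i).toReal ∧
      (q t h i).toReal ≤ (1 + ε₂) * seedProb x h i

/-- The law of the sequence of the first `t` data points chosen as centers: each one is sampled from
the distribution that the strategy assigns to the sequence of its predecessors. -/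
noncomputable def law {ι : Type*} (q : Strategy ι) : (t : ℕ) → PMF (Fin t → ι)
  | 0 => PMF.pure Fin.elim0
  | t + 1 => (law q t).bind fun h => (q t h).map fun i => (Fin.snoc h i : Fin (t + 1) → ι)

/-- The expected cost `E[Φ(X, T_k)]` of the random set `T_k` of the `k` sampled centers. -/
noncomputable def expectedCost {d : ℕ} {ι : Type*} [Fintype ι] (x : ι → Pt d) (q : Strategy ι)
    (k : ℕ) : ℝ :=
  ∑ c : Fin k → ι, (law q k c).toReal * cost x (centers x c)

/-- The threshold `max {18, 24 (ε₁ + ε₂) (1 + ε₂) / (1 - ε₁)²}`. -/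
noncomputable def threshold (ε₁ ε₂ : ℝ) : ℝ :=
  max 18 (24 * (ε₁ + ε₂) * (1 + ε₂) / (1 - ε₁) ^ 2)

end NoisyKMeans

/-! Fix any `k` centers, with the data points assigned to them as clusters, and write `R = (1 + ε₂)
/ (1 - ε₁)`. The final cost splits into covered and uncovered clusters.

Covered clusters: conditioned on a cluster being hit for the first time, the noisy choice inside it
differs from exact sampling by a factor of at most `R`, so its expected cost is at most `16 R` times
its reference cost; later choices only lower it. Hence `potential` is a supermartingale
(`IsNoisy.expect_coveredCost_le`).

Uncovered clusters: after `k` choices there are as many of them as wasted choices, so they cost at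
most `wasted * maxUncovered`. With current cost `Φ`, a choice is wasted with probability at most `(1
+ ε₂) * coveredCost / Φ`. On the other hand, expensive uncovered clusters are likely to be hit soon:
`r` choices later the largest uncovered cost is expected to be at most `Φ * (ln k / ((1 - ε₁) r) + 1
/ k)`. In the product `Φ` cancels, and each choice contributes a multiple of the expected covered
cost (`IsNoisy.expect_wasted_mul_le`). Summing over `r` gives a harmonic sum, hence a bound of order
`R² ln² k`.

This bound holds for every `k ≥ 2`. It implies the first claim since `R ≥ 1`; in the second regime,
`k` is so small that `ln k` is at most a multiple of `max 1 (ln R)`. -/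

namespace NoisyKMeans

variable {d : ℕ} {ι J : Type*}

/-! ### Expectations over the random choices -/

section Expectation

variable [Fintype ι]

/-- The expectation of a function of the first `t` choices. -/
noncomputable def expect (q : Strategy ι) (t : ℕ) (f : (Fin t → ι) → ℝ) : ℝ :=
  ∑ c : Fin t → ι, (law q t c).toReal * f c

/-- The expectation of a function of the first `t + 1` choices, given the first `t` of them. -/
noncomputable def step (q : Strategy ι) {t : ℕ} (f : (Fin (t + 1) → ι) → ℝ) (h : Fin t → ι) : ℝ :=
  ∑ i, (q t h i).toReal * f (Fin.snoc h i)

theorem sum_toReal_pmf {α : Type*} [Fintype α] (p : PMF α) : ∑ a, (p a).toReal = 1 := by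
  rw [← ENNReal.toReal_sum (fun a _ => p.apply_ne_top a), ← tsum_fintype (L := .unconditional _),
    p.tsum_coe]
  rfl

theorem toReal_bind_apply {α β : Type*} [Fintype α] (p : PMF α) (f : α → PMF β) (b : β) :
    (p.bind f b).toReal = ∑ a, (p a).toReal * (f a b).toReal := by
  rw [PMF.bind_apply, tsum_fintype, ENNReal.toReal_sum]
  · simp only [ENNReal.toReal_mul]
  · exact fun a _ => ENNReal.mul_ne_top (p.apply_ne_top a) ((f a).apply_ne_top b)

theorem sum_toReal_map {α β : Type*} [Fintype α] [Fintype β] (p : PMF α) (g : α → β) (f : β → ℝ) :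
    ∑ b, (p.map g b).toReal * f b = ∑ a, (p a).toReal * f (g a) := by
  classical
  simp only [PMF.map, toReal_bind_apply, Finset.sum_mul]
  rw [Finset.sum_comm]
  refine Finset.sum_congr rfl fun a _ => ?_
  rw [Finset.sum_eq_single (g a)]
  · simp
  · intro b _ hb
    simp [PMF.pure_apply, hb]
  · simp

theorem expect_succ (q : Strategy ι) (t : ℕ) (f : (Fin (t + 1) → ι) → ℝ) :
    expect q (t + 1) f = expect q t (step q f) := by
  simp only [expect, law, toReal_bind_apply, Finset.sum_mul, step]
  rw [Finset.sum_comm]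
  refine Finset.sum_congr rfl fun h _ => ?_
  rw [← sum_toReal_map (q t h) (fun i => (Fin.snoc h i : Fin (t + 1) → ι)) f, Finset.mul_sum]
  exact Finset.sum_congr rfl fun c _ => by ring

theorem expect_zero (q : Strategy ι) (f : (Fin 0 → ι) → ℝ) : expect q 0 f = f Fin.elim0 := by
  have h := sum_toReal_pmf (law q 0)
  rw [Fintype.sum_unique] at h
  rw [expect, Fintype.sum_unique, h, one_mul]
  exact congrArg f (Subsingleton.elim _ _)

theorem expect_mono (q : Strategy ι) {t : ℕ} {f g : (Fin t → ι) → ℝ} (hfg : ∀ h, f h ≤ g h) :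
    expect q t f ≤ expect q t g :=
  Finset.sum_le_sum fun c _ => mul_le_mul_of_nonneg_left (hfg c) ENNReal.toReal_nonneg

theorem expect_add (q : Strategy ι) {t : ℕ} (f g : (Fin t → ι) → ℝ) :
    expect q t (fun h => f h + g h) = expect q t f + expect q t g := by
  simp only [expect, mul_add, Finset.sum_add_distrib]

theorem expect_const_mul (q : Strategy ι) {t : ℕ} (a : ℝ) (f : (Fin t → ι) → ℝ) :
    expect q t (fun h => a * f h) = a * expect q t f := by
  simp only [expect, Finset.mul_sum]
  exact Finset.sum_congr rfl fun c _ => by ring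

end Expectation

/-! ### Squared distances -/

theorem bddBelow_sqDist (y : Pt d) (C : Set (Pt d)) :
    BddBelow (Set.range fun c : C => ‖y - (c : Pt d)‖ ^ 2) :=
  ⟨0, by rintro _ ⟨c, rfl⟩; positivity⟩

theorem sqDist_nonneg (y : Pt d) (C : Set (Pt d)) : 0 ≤ sqDist y C :=
  Real.iInf_nonneg fun _ => by positivity

theorem sqDist_le {C : Set (Pt d)} (y : Pt d) {c : Pt d} (hc : c ∈ C) :
    sqDist y C ≤ ‖y - c‖ ^ 2 :=
  ciInf_le (bddBelow_sqDist y C) ⟨c, hc⟩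

theorem sqDist_anti {C D : Set (Pt d)} (hC : C.Nonempty) (hCD : C ⊆ D) (y : Pt d) :
    sqDist y D ≤ sqDist y C :=
  haveI := hC.to_subtype
  le_ciInf fun c => sqDist_le y (hCD c.2)

theorem sq_norm_sub_le (a b c : Pt d) : ‖a - b‖ ^ 2 ≤ 2 * ‖a - c‖ ^ 2 + 2 * ‖b - c‖ ^ 2 := by
  have h : ‖a - b‖ ≤ ‖a - c‖ + ‖b - c‖ := by
    rw [← norm_neg (b - c), neg_sub]
    exact norm_sub_le_norm_sub_add_norm_sub a c b
  nlinarith [sq_nonneg (‖a - c‖ - ‖b - c‖), norm_nonneg (a - b)]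

/-- The relaxed triangle inequality via the center nearest to `z`; averaging over `z` in a cluster
bounds the sampling weight of `y`. -/
theorem sqDist_le_two_mul {C : Set (Pt d)} (hC : C.Nonempty) (y z : Pt d) :
    sqDist y C ≤ 2 * sqDist z C + 2 * ‖z - y‖ ^ 2 := by
  have := hC.to_subtype
  have : (sqDist y C - 2 * ‖z - y‖ ^ 2) / 2 ≤ sqDist z C := by
    refine le_ciInf fun c => ?_
    have h1 := sqDist_le y c.2
    have h2 := sq_norm_sub_le y (c : Pt d) z
    rw [norm_sub_rev y z, norm_sub_rev (c : Pt d) z] at h2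
    linarith
  linarith

/-- A finite family of points has pairwise squared distances of sum at most `4 |s|` times its
cost with respect to any single center. -/
theorem sum_sum_sq_norm_sub_le (x : ι → Pt d) (s : Finset ι) (c : Pt d) :
    ∑ a ∈ s, ∑ b ∈ s, ‖x b - x a‖ ^ 2 ≤ 4 * s.card * ∑ a ∈ s, ‖x a - c‖ ^ 2 := by
  calc ∑ a ∈ s, ∑ b ∈ s, ‖x b - x a‖ ^ 2
      ≤ ∑ a ∈ s, ∑ b ∈ s, (2 * ‖x b - c‖ ^ 2 + 2 * ‖x a - c‖ ^ 2) :=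
        Finset.sum_le_sum fun a _ => Finset.sum_le_sum fun b _ => sq_norm_sub_le _ _ _
    _ = 4 * s.card * ∑ a ∈ s, ‖x a - c‖ ^ 2 := by
        simp only [Finset.sum_add_distrib, Finset.sum_const, nsmul_eq_mul, ← Finset.mul_sum]
        ring

/-- `D²`-sampling from a cluster yields a constant factor approximation of the cluster. -/
theorem sum_sqDist_mul_le (x : ι → Pt d) (s : Finset ι) (c : Pt d) {C : Set (Pt d)}
    (hC : C.Nonempty) :
    ∑ a ∈ s, sqDist (x a) C * ∑ b ∈ s, sqDist (x b) (insert (x a) C) ≤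
      16 * (∑ a ∈ s, ‖x a - c‖ ^ 2) * ∑ a ∈ s, sqDist (x a) C := by
  rcases s.eq_empty_or_nonempty with rfl | hs
  · simp
  have hn : (0 : ℝ) < s.card := by exact_mod_cast hs.card_pos
  set S := ∑ a ∈ s, sqDist (x a) C with hS
  have hS0 : 0 ≤ S := Finset.sum_nonneg fun a _ => sqDist_nonneg _ _
  -- The factor `|s|` turns the weight of `a` into a sum over `b ∈ s`, to which the relaxed triangle
  -- inequality applies.
  refine le_of_mul_le_mul_left ?_ hn
  have key : ∀ a ∈ s, s.card * (sqDist (x a) C * ∑ b ∈ s, sqDist (x b) (insert (x a) C)) ≤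
      4 * S * ∑ b ∈ s, ‖x b - x a‖ ^ 2 := by
    intro a _
    have h1 : s.card * sqDist (x a) C ≤ 2 * S + 2 * ∑ b ∈ s, ‖x b - x a‖ ^ 2 := by
      calc (s.card : ℝ) * sqDist (x a) C = ∑ b ∈ s, sqDist (x a) C := by simp
        _ ≤ ∑ b ∈ s, (2 * sqDist (x b) C + 2 * ‖x b - x a‖ ^ 2) :=
          Finset.sum_le_sum fun b _ => sqDist_le_two_mul hC _ _
        _ = _ := by rw [Finset.sum_add_distrib, ← Finset.mul_sum, ← Finset.mul_sum]
    set N := ∑ b ∈ s, sqDist (x b) (insert (x a) C)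
    set Q := ∑ b ∈ s, ‖x b - x a‖ ^ 2
    have hN0 : 0 ≤ N := Finset.sum_nonneg fun b _ => sqDist_nonneg _ _
    have hNS : N ≤ S := Finset.sum_le_sum fun b _ => sqDist_anti hC (Set.subset_insert _ _) _
    have hNQ : N ≤ Q := Finset.sum_le_sum fun b _ => sqDist_le _ (Set.mem_insert _ _)
    have hQ0 : 0 ≤ Q := hN0.trans hNQ
    -- From `(2S + 2Q) N`: use `N ≤ Q` in the first term and `N ≤ S` in the second, which gives `4 S
    -- Q`.
    nlinarith [mul_le_mul_of_nonneg_right h1 hN0, mul_le_mul_of_nonneg_left hNQ hS0,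
      mul_le_mul_of_nonneg_left hNS hQ0]
  calc (s.card : ℝ) * ∑ a ∈ s, sqDist (x a) C * ∑ b ∈ s, sqDist (x b) (insert (x a) C)
      ≤ ∑ a ∈ s, 4 * S * ∑ b ∈ s, ‖x b - x a‖ ^ 2 := by
        rw [Finset.mul_sum]; exact Finset.sum_le_sum key
    _ = 4 * S * ∑ a ∈ s, ∑ b ∈ s, ‖x b - x a‖ ^ 2 := (Finset.mul_sum _ _ _).symm
    _ ≤ 4 * S * (4 * s.card * ∑ a ∈ s, ‖x a - c‖ ^ 2) :=
        mul_le_mul_of_nonneg_left (sum_sum_sq_norm_sub_le x s c) (by positivity)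
    _ = _ := by ring

/-! ### Clusters and histories -/

theorem centers_snoc (x : ι → Pt d) {t : ℕ} (h : Fin t → ι) (i : ι) :
    centers x (Fin.snoc h i : Fin (t + 1) → ι) = insert (x i) (centers x h) := by
  ext y
  simp only [centers, Set.mem_range, Set.mem_insert_iff]
  constructor
  · rintro ⟨s, rfl⟩
    induction s using Fin.lastCases with
    | last => simp
    | cast s => exact Or.inr ⟨s, by simp⟩
  · rintro (rfl | ⟨s, rfl⟩)
    · exact ⟨Fin.last t, by simp⟩
    · exact ⟨s.castSucc, by simp⟩

theorem centers_nonempty (x : ι → Pt d) {t : ℕ} (ht : t ≠ 0) (h : Fin t → ι) :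
    (centers x h).Nonempty :=
  ⟨_, ⟨⟨0, Nat.pos_of_ne_zero ht⟩, rfl⟩⟩

theorem cost_nonneg [Fintype ι] (x : ι → Pt d) (C : Set (Pt d)) : 0 ≤ cost x C :=
  Finset.sum_nonneg fun _ _ => sqDist_nonneg _ _

theorem cost_snoc_le [Fintype ι] (x : ι → Pt d) {t : ℕ} (ht : t ≠ 0) (h : Fin t → ι) (i : ι) :
    cost x (centers x (Fin.snoc h i : Fin (t + 1) → ι)) ≤ cost x (centers x h) := by
  rw [centers_snoc]
  exact Finset.sum_le_sum fun b _ =>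
    sqDist_anti (centers_nonempty x ht h) (Set.subset_insert _ _) _

/-- A cluster is covered if one of the chosen data points belongs to it. -/
def Covered (cl : ι → J) {t : ℕ} (h : Fin t → ι) (j : J) : Prop := ∃ s, cl (h s) = j

theorem covered_snoc (cl : ι → J) {t : ℕ} (h : Fin t → ι) (i : ι) (j : J) :
    Covered cl (Fin.snoc h i : Fin (t + 1) → ι) j ↔ cl i = j ∨ Covered cl h j := by
  constructor
  · rintro ⟨s, rfl⟩
    induction s using Fin.lastCases with
    | last => simp
    | cast s => exact Or.inr ⟨s, by simp⟩
  · rintro (rfl | ⟨s, rfl⟩)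
    · exact ⟨Fin.last t, by simp⟩
    · exact ⟨s.castSucc, by simp⟩

theorem Covered.ne_zero {cl : ι → J} {t : ℕ} {h : Fin t → ι} {j : J} (hj : Covered cl h j) :
    t ≠ 0 := by
  rintro rfl
  exact hj.choose.elim0

open scoped Classical in
/-- The number of choices that did not cover a new cluster. -/
noncomputable def wasted [Fintype J] (cl : ι → J) {t : ℕ} (h : Fin t → ι) : ℝ :=
  t - ∑ j : J, if Covered cl h j then 1 else 0

theorem wasted_snoc [Fintype J] (cl : ι → J) {t : ℕ} (h : Fin t → ι) (i : ι)
    [Decidable (Covered cl h (cl i))] :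
    wasted cl (Fin.snoc h i : Fin (t + 1) → ι) =
      wasted cl h + if Covered cl h (cl i) then 1 else 0 := by
  classical
  have : ∀ j : J, (if Covered cl (Fin.snoc h i : Fin (t + 1) → ι) j then (1 : ℝ) else 0) =
      (if Covered cl h j then 1 else 0) +
        if j = cl i then (if Covered cl h (cl i) then 0 else 1) else 0 := by
    intro j
    rw [if_congr (covered_snoc cl h i j) rfl rfl]
    by_cases h1 : cl i = j
    · subst h1
      by_cases h2 : Covered cl h (cl i) <;> simp [h2]
    · simp [h1, Ne.symm h1]
  simp only [wasted, this, Finset.sum_add_distrib, Finset.sum_ite_eq', Finset.mem_univ, if_true]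
  push_cast
  split_ifs <;> ring

theorem wasted_zero [Fintype J] (cl : ι → J) (h : Fin 0 → ι) : wasted cl h = 0 := by
  simp [wasted, Covered]

variable [Fintype ι]

open scoped Classical in
/-- The cost of a single cluster with respect to the chosen centers. -/
noncomputable def clusterCost (x : ι → Pt d) (cl : ι → J) {t : ℕ} (h : Fin t → ι) (j : J) : ℝ :=
  ∑ i with cl i = j, sqDist (x i) (centers x h)

open scoped Classical in
/-- The total cost of the covered clusters. -/
noncomputable def coveredCost [Fintype J] (x : ι → Pt d) (cl : ι → J) {t : ℕ} (h : Fin t → ι) : ℝ :=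
  ∑ j with Covered cl h j, clusterCost x cl h j

open scoped Classical in
/-- The cost of the most expensive uncovered cluster. -/
noncomputable def maxUncovered (x : ι → Pt d) (cl : ι → J) {t : ℕ} (h : Fin t → ι) : ℝ :=
  ⨆ j : J, if Covered cl h j then 0 else clusterCost x cl h j

theorem clusterCost_nonneg (x : ι → Pt d) (cl : ι → J) {t : ℕ} (h : Fin t → ι) (j : J) :
    0 ≤ clusterCost x cl h j :=
  Finset.sum_nonneg fun _ _ => sqDist_nonneg _ _

theorem clusterCost_snoc_le (x : ι → Pt d) (cl : ι → J) {t : ℕ} (ht : t ≠ 0) (h : Fin t → ι)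
    (i : ι) (j : J) :
    clusterCost x cl (Fin.snoc h i : Fin (t + 1) → ι) j ≤ clusterCost x cl h j := by
  unfold clusterCost
  rw [centers_snoc]
  exact Finset.sum_le_sum fun b _ =>
    sqDist_anti (centers_nonempty x ht h) (Set.subset_insert _ _) _

theorem sum_clusterCost [Fintype J] (x : ι → Pt d) (cl : ι → J) {t : ℕ} (h : Fin t → ι) :
    ∑ j, clusterCost x cl h j = cost x (centers x h) := by
  classical
  simp only [clusterCost, cost]
  exact Finset.sum_fiberwise _ _ _

theorem clusterCost_le_cost [Fintype J] (x : ι → Pt d) (cl : ι → J) {t : ℕ} (h : Fin t → ι)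
    (j : J) : clusterCost x cl h j ≤ cost x (centers x h) := by
  rw [← sum_clusterCost x cl h]
  exact Finset.single_le_sum (fun j _ => clusterCost_nonneg x cl h j) (Finset.mem_univ j)

theorem coveredCost_nonneg [Fintype J] (x : ι → Pt d) (cl : ι → J) {t : ℕ} (h : Fin t → ι) :
    0 ≤ coveredCost x cl h :=
  Finset.sum_nonneg fun _ _ => clusterCost_nonneg _ _ _ _

theorem le_maxUncovered [Finite J] (x : ι → Pt d) (cl : ι → J) {t : ℕ} {h : Fin t → ι} {j : J}
    (hj : ¬ Covered cl h j) : clusterCost x cl h j ≤ maxUncovered x cl h := by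
  classical
  have := le_ciSup (f := fun j : J => if Covered cl h j then 0 else clusterCost x cl h j)
    (Set.finite_range _).bddAbove j
  rw [if_neg hj] at this
  exact this

theorem maxUncovered_le_cost [Fintype J] (x : ι → Pt d) (cl : ι → J) {t : ℕ} (h : Fin t → ι) :
    maxUncovered x cl h ≤ cost x (centers x h) :=
  Real.iSup_le (fun j => by
    split_ifs
    exacts [cost_nonneg _ _, clusterCost_le_cost _ _ _ _]) (cost_nonneg _ _)

/-- When there are as many choices as clusters, there are as many uncovered clusters as wasted
choices. -/
theorem cost_le_coveredCost_add [Fintype J] (x : ι → Pt d) (cl : ι → J)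
    (h : Fin (Fintype.card J) → ι) :
    cost x (centers x h) ≤ coveredCost x cl h + wasted cl h * maxUncovered x cl h := by
  classical
  have hw : wasted cl h = ∑ j : J, if Covered cl h j then (0 : ℝ) else 1 := by
    have : (Fintype.card J : ℝ) = ∑ j : J, (1 : ℝ) := by simp
    rw [wasted, this, ← Finset.sum_sub_distrib]
    refine Finset.sum_congr rfl fun j _ => ?_
    split_ifs <;> simp
  rw [hw, ← sum_clusterCost x cl h, coveredCost, Finset.sum_filter, Finset.sum_mul,
    ← Finset.sum_add_distrib]
  refine Finset.sum_le_sum fun j _ => ?_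
  by_cases hj : Covered cl h j
  · simp [hj]
  · simpa [hj] using le_maxUncovered x cl hj

/-! ### One step of the noisy sampling -/

section Step

variable {x : ι → Pt d} {ε₁ ε₂ : ℝ} {q : Strategy ι} {t : ℕ}

theorem IsNoisy.le_sum (hq : IsNoisy x ε₁ ε₂ q) (ht : t ≠ 0) {h : Fin t → ι}
    (hpos : 0 < cost x (centers x h)) (s : Finset ι) :
    (1 - ε₁) * ((∑ i ∈ s, sqDist (x i) (centers x h)) / cost x (centers x h)) ≤
      ∑ i ∈ s, (q t h i).toReal := by
  rw [Finset.sum_div, Finset.mul_sum]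
  refine Finset.sum_le_sum fun i _ => ?_
  simpa only [seedProb, if_neg ht] using (hq t h (Or.inr hpos) i).1

theorem IsNoisy.sum_le (hq : IsNoisy x ε₁ ε₂ q) (ht : t ≠ 0) {h : Fin t → ι}
    (hpos : 0 < cost x (centers x h)) (s : Finset ι) :
    ∑ i ∈ s, (q t h i).toReal ≤
      (1 + ε₂) * ((∑ i ∈ s, sqDist (x i) (centers x h)) / cost x (centers x h)) := by
  rw [Finset.sum_div, Finset.mul_sum]
  refine Finset.sum_le_sum fun i _ => ?_
  simpa only [seedProb, if_neg ht] using (hq t h (Or.inr hpos) i).2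

open scoped Classical in
/-- The first center chosen in a cluster yields a constant factor approximation of it. -/
theorem IsNoisy.sum_mul_clusterCost_snoc_le [Fintype J] (hq : IsNoisy x ε₁ ε₂ q) (hε₁ : ε₁ < 1) (hε₂ : 0 ≤ ε₂)
    (cl : ι → J) (h : Fin t → ι) (j : J) (c : Pt d) :
    ∑ i with cl i = j, (q t h i).toReal *
        clusterCost x cl (Fin.snoc h i : Fin (t + 1) → ι) j ≤
      16 * ((1 + ε₂) / (1 - ε₁)) * (∑ i with cl i = j, ‖x i - c‖ ^ 2) *
        ∑ i with cl i = j, (q t h i).toReal := by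
  set s : Finset ι := {i | cl i = j}
  set o := ∑ i ∈ s, ‖x i - c‖ ^ 2 with ho
  have ho0 : 0 ≤ o := Finset.sum_nonneg fun _ _ => by positivity
  have hε₁' : 0 < 1 - ε₁ := sub_pos.2 hε₁
  have hR0 : 0 ≤ (1 + ε₂) / (1 - ε₁) := by positivity
  rcases eq_or_ne t 0 with rfl | ht
  · have hn : 0 ≤ 1 / (Fintype.card ι : ℝ) := by positivity
    have hcc : ∀ i ∈ s, clusterCost x cl (Fin.snoc h i : Fin (0 + 1) → ι) j ≤
        ∑ b ∈ s, ‖x b - x i‖ ^ 2 := by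
      intro i _
      unfold clusterCost
      rw [centers_snoc]
      exact Finset.sum_le_sum fun b _ => sqDist_le _ (Set.mem_insert _ _)
    have hlow : (1 - ε₁) * (s.card * (1 / (Fintype.card ι : ℝ))) ≤ ∑ i ∈ s, (q 0 h i).toReal := by
      rw [← nsmul_eq_mul, ← Finset.sum_const, Finset.mul_sum]
      refine Finset.sum_le_sum fun i _ => ?_
      simpa only [seedProb, if_true] using (hq 0 h (Or.inl rfl) i).1
    calc ∑ i ∈ s, (q 0 h i).toReal * clusterCost x cl (Fin.snoc h i : Fin (0 + 1) → ι) j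
        ≤ ∑ i ∈ s, (1 + ε₂) * (1 / (Fintype.card ι : ℝ)) * ∑ b ∈ s, ‖x b - x i‖ ^ 2 := by
          refine Finset.sum_le_sum fun i hi => ?_
          refine mul_le_mul ?_ (hcc i hi) (clusterCost_nonneg _ _ _ _) (by positivity)
          simpa only [seedProb, if_true] using (hq 0 h (Or.inl rfl) i).2
      _ = (1 + ε₂) * (1 / (Fintype.card ι : ℝ)) * ∑ i ∈ s, ∑ b ∈ s, ‖x b - x i‖ ^ 2 :=
          (Finset.mul_sum _ _ _).symm
      _ ≤ (1 + ε₂) * (1 / (Fintype.card ι : ℝ)) * (4 * s.card * o) :=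
          mul_le_mul_of_nonneg_left (sum_sum_sq_norm_sub_le x s c) (by positivity)
      _ = 4 * ((1 + ε₂) / (1 - ε₁)) * o * ((1 - ε₁) * (s.card * (1 / (Fintype.card ι : ℝ)))) := by
          field_simp
      _ ≤ 16 * ((1 + ε₂) / (1 - ε₁)) * o * ((1 - ε₁) * (s.card * (1 / (Fintype.card ι : ℝ)))) := by
          gcongr; norm_num
      _ ≤ _ := mul_le_mul_of_nonneg_left hlow (by positivity)
  -- At cost zero the strategy is unconstrained, but every cluster cost vanishes.
  · rcases (cost_nonneg x (centers x h)).eq_or_lt with h0 | hpos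
    · have hz : ∀ i ∈ s, (q t h i).toReal *
          clusterCost x cl (Fin.snoc h i : Fin (t + 1) → ι) j = 0 := by
        intro i _
        rw [(((clusterCost_snoc_le x cl ht h i j).trans (clusterCost_le_cost x cl h j)).trans_eq
          h0.symm).antisymm (clusterCost_nonneg _ _ _ _), mul_zero]
      rw [Finset.sum_eq_zero hz]
      exact mul_nonneg (by positivity) (Finset.sum_nonneg fun _ _ => ENNReal.toReal_nonneg)
    · have hC := centers_nonempty x ht h
      set Φ := cost x (centers x h)
      calc ∑ i ∈ s, (q t h i).toReal * clusterCost x cl (Fin.snoc h i : Fin (t + 1) → ι) j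
          ≤ ∑ i ∈ s, (1 + ε₂) / Φ * (sqDist (x i) (centers x h) *
              ∑ b ∈ s, sqDist (x b) (insert (x i) (centers x h))) := by
            refine Finset.sum_le_sum fun i _ => ?_
            rw [← mul_assoc]
            refine mul_le_mul ?_ ?_ (clusterCost_nonneg _ _ _ _)
              (mul_nonneg (by positivity) (sqDist_nonneg _ _))
            · have := hq.sum_le ht hpos {i}
              rw [Finset.sum_singleton, Finset.sum_singleton] at this
              exact this.trans_eq (by ring)
            · unfold clusterCost
              rw [centers_snoc]
        _ = (1 + ε₂) / Φ * ∑ i ∈ s, (sqDist (x i) (centers x h) *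
              ∑ b ∈ s, sqDist (x b) (insert (x i) (centers x h))) := (Finset.mul_sum _ _ _).symm
        _ ≤ (1 + ε₂) / Φ * (16 * o * ∑ i ∈ s, sqDist (x i) (centers x h)) :=
            mul_le_mul_of_nonneg_left (sum_sqDist_mul_le x s c hC) (by positivity)
        _ = 16 * ((1 + ε₂) / (1 - ε₁)) * o *
              ((1 - ε₁) * ((∑ i ∈ s, sqDist (x i) (centers x h)) / Φ)) := by
            field_simp
        _ ≤ _ := mul_le_mul_of_nonneg_left (hq.le_sum ht hpos s) (by positivity)

open scoped Classical in
/-- The cost of the covered clusters plus a multiple of the optimal cost of the uncovered ones. -/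
noncomputable def potential [Fintype J] (x : ι → Pt d) (cl : ι → J) (o : J → ℝ) {t : ℕ}
    (h : Fin t → ι) : ℝ :=
  ∑ j, if Covered cl h j then clusterCost x cl h j else o j

open scoped Classical in
/-- The potential is a supermartingale. -/
theorem IsNoisy.step_potential_le [Fintype J] (hq : IsNoisy x ε₁ ε₂ q) (hε₁ : ε₁ < 1)
    (hε₂ : 0 ≤ ε₂) (cl : ι → J) (c : J → Pt d) {o : J → ℝ}
    (ho : ∀ j, o j = 16 * ((1 + ε₂) / (1 - ε₁)) *
      ∑ i with cl i = j, ‖x i - c j‖ ^ 2) (h : Fin t → ι) :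
    step q (potential x cl o) h ≤ potential x cl o h := by
  simp only [step, potential, Finset.mul_sum]
  rw [Finset.sum_comm]
  refine Finset.sum_le_sum fun j _ => ?_
  by_cases hj : Covered cl h j
  · rw [if_pos hj]
    calc _ ≤ ∑ i, (q t h i).toReal * clusterCost x cl h j := by
          refine Finset.sum_le_sum fun i _ => mul_le_mul_of_nonneg_left ?_ ENNReal.toReal_nonneg
          rw [if_pos ((covered_snoc _ _ _ _).2 (Or.inr hj))]
          exact clusterCost_snoc_le x cl hj.ne_zero h i j
      _ = _ := by rw [← Finset.sum_mul, sum_toReal_pmf, one_mul]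
  -- Only a choice inside `j` changes its term, and the constant in `o j` is what such a choice
  -- costs on average.
  · rw [if_neg hj, ← Finset.sum_filter_add_sum_filter_not _ (fun i => cl i = j)]
    have h1 : ∑ i with cl i = j, (q t h i).toReal *
        (if Covered cl (Fin.snoc h i : Fin (t + 1) → ι) j then
          clusterCost x cl (Fin.snoc h i : Fin (t + 1) → ι) j else o j) ≤
        ∑ i with cl i = j, (q t h i).toReal * o j := by
      calc _ = ∑ i with cl i = j, (q t h i).toReal *
            clusterCost x cl (Fin.snoc h i : Fin (t + 1) → ι) j := by
            refine Finset.sum_congr rfl fun i hi => ?_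
            rw [if_pos ((covered_snoc _ _ _ _).2 (Or.inl (Finset.mem_filter.1 hi).2))]
        _ ≤ _ := hq.sum_mul_clusterCost_snoc_le hε₁ hε₂ cl h j (c j)
        _ = _ := by rw [← Finset.sum_mul, ho j, mul_comm]
    have h2 : ∑ i with ¬ cl i = j, (q t h i).toReal *
        (if Covered cl (Fin.snoc h i : Fin (t + 1) → ι) j then
          clusterCost x cl (Fin.snoc h i : Fin (t + 1) → ι) j else o j) =
        ∑ i with ¬ cl i = j, (q t h i).toReal * o j := by
      refine Finset.sum_congr rfl fun i hi => ?_
      rw [if_neg]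
      rw [covered_snoc]
      exact not_or.2 ⟨(Finset.mem_filter.1 hi).2, hj⟩
    rw [h2]
    refine (add_le_add_left h1 _).trans_eq ?_
    rw [Finset.sum_filter_add_sum_filter_not, ← Finset.sum_mul, sum_toReal_pmf, one_mul]

/-- The expected cost of the covered clusters is within a constant factor of the optimum. -/
theorem IsNoisy.expect_coveredCost_le [Fintype J] (hq : IsNoisy x ε₁ ε₂ q) (hε₁ : ε₁ < 1)
    (hε₂ : 0 ≤ ε₂) (cl : ι → J) (c : J → Pt d) (t : ℕ) :
    expect q t (coveredCost x cl) ≤ 16 * ((1 + ε₂) / (1 - ε₁)) * ∑ i, ‖x i - c (cl i)‖ ^ 2 := by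
  classical
  set o : J → ℝ := fun j => 16 * ((1 + ε₂) / (1 - ε₁)) *
      ∑ i with cl i = j, ‖x i - c j‖ ^ 2 with ho
  have hε₁' : 0 < 1 - ε₁ := sub_pos.2 hε₁
  have ho0 : ∀ j, 0 ≤ o j := fun j => by positivity
  have hpot : ∀ t, expect q t (potential x cl o) ≤ ∑ j, o j := by
    intro t
    induction t with
    | zero => simp [expect_zero, potential, Covered]
    | succ t ih =>
      rw [expect_succ]
      exact (expect_mono q fun h => hq.step_potential_le hε₁ hε₂ cl c (fun j => rfl) h).trans ih
  calc expect q t (coveredCost x cl) ≤ expect q t (potential x cl o) := by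
        refine expect_mono q fun h => ?_
        rw [coveredCost, Finset.sum_filter]
        refine Finset.sum_le_sum fun j _ => ?_
        split_ifs
        exacts [le_rfl, ho0 j]
    _ ≤ ∑ j, o j := hpot t
    _ = _ := by
        rw [ho, ← Finset.mul_sum]
        congr 1
        rw [← Finset.sum_fiberwise Finset.univ cl]
        refine Finset.sum_congr rfl fun j _ => ?_
        refine Finset.sum_congr rfl fun i hi => ?_
        rw [(Finset.mem_filter.1 hi).2]

end Step

/-! ### Future costs -/

/-- The conditional expectation of `f` after `r` further choices. -/
noncomputable def future (q : Strategy ι) (f : ∀ t, (Fin t → ι) → ℝ) :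
    ℕ → ∀ t, (Fin t → ι) → ℝ
  | 0 => f
  | r + 1 => fun _ => step q (future q f r _)

section Future

variable {x : ι → Pt d} {ε₁ ε₂ : ℝ} {q : Strategy ι} {t : ℕ}

open scoped Classical in
/-- The total cost of the uncovered clusters of cost more than `y`. -/
noncomputable def excess [Fintype J] (x : ι → Pt d) (cl : ι → J) (y : ℝ) {t : ℕ} (h : Fin t → ι) :
    ℝ :=
  ∑ j, if ¬ Covered cl h j ∧ y < clusterCost x cl h j then clusterCost x cl h j else 0

/-- Clusters above `y` are bounded by their sum, which, unlike the maximum, can be contracted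
cluster by cluster. -/
theorem maxUncovered_le_add_excess [Fintype J] (x : ι → Pt d) (cl : ι → J) {y : ℝ} (hy : 0 ≤ y)
    (h : Fin t → ι) : maxUncovered x cl h ≤ y + excess x cl y h := by
  classical
  have h0 : ∀ j, 0 ≤ if ¬ Covered cl h j ∧ y < clusterCost x cl h j
      then clusterCost x cl h j else 0 := fun j => by
    split_ifs
    exacts [clusterCost_nonneg _ _ _ _, le_rfl]
  have hs : 0 ≤ excess x cl y h := Finset.sum_nonneg fun j _ => h0 j
  refine Real.iSup_le (fun j => ?_) (add_nonneg hy hs)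
  split_ifs with hj
  · exact add_nonneg hy hs
  · rcases le_or_gt (clusterCost x cl h j) y with h1 | h1
    · linarith
    · have := Finset.single_le_sum (fun j _ => h0 j) (Finset.mem_univ j)
      rw [if_pos ⟨hj, h1⟩] at this
      change _ ≤ excess x cl y h at this
      linarith

theorem excess_le_cost [Fintype J] (x : ι → Pt d) (cl : ι → J) (y : ℝ) (h : Fin t → ι) :
    excess x cl y h ≤ cost x (centers x h) := by
  rw [← sum_clusterCost x cl h]
  refine Finset.sum_le_sum fun j _ => ?_
  split_ifs
  exacts [le_rfl, clusterCost_nonneg _ _ _ _]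

/-- An expensive uncovered cluster is missed with a probability bounded away from one. -/
theorem IsNoisy.step_excess_le [Fintype J] (hq : IsNoisy x ε₁ ε₂ q) (hε₁ : ε₁ < 1)
    (cl : ι → J) (ht : t ≠ 0) {y Φ : ℝ} (hy : 0 ≤ y) {h : Fin t → ι}
    (hΦ : cost x (centers x h) ≤ Φ) :
    step q (excess x cl y) h ≤ Real.exp (-((1 - ε₁) * (y / Φ))) * excess x cl y h := by
  classical
  have hε₁' : 0 < 1 - ε₁ := sub_pos.2 hε₁
  simp only [step, excess, Finset.mul_sum]
  rw [Finset.sum_comm]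
  refine Finset.sum_le_sum fun j _ => ?_
  by_cases hj : ¬ Covered cl h j ∧ y < clusterCost x cl h j
  · rw [if_pos hj]
    have hpos : 0 < cost x (centers x h) :=
      (hy.trans_lt hj.2).trans_le (clusterCost_le_cost x cl h j)
    have hhit : (1 - ε₁) * (y / Φ) ≤ ∑ i with cl i = j, (q t h i).toReal := by
      refine le_trans ?_ (hq.le_sum ht hpos _)
      refine mul_le_mul_of_nonneg_left ?_ hε₁'.le
      refine div_le_div₀ (clusterCost_nonneg x cl h j) ?_ hpos hΦ
      refine hj.2.le.trans_eq ?_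
      simp only [clusterCost]
    have hmiss : ∑ i with ¬ cl i = j, (q t h i).toReal ≤ Real.exp (-((1 - ε₁) * (y / Φ))) := by
      have h1 := Finset.sum_filter_add_sum_filter_not Finset.univ (fun i => cl i = j)
        (fun i => (q t h i).toReal)
      rw [sum_toReal_pmf] at h1
      have h2 := Real.add_one_le_exp (-((1 - ε₁) * (y / Φ)))
      linarith
    calc _ ≤ ∑ i, if ¬ cl i = j then (q t h i).toReal * clusterCost x cl h j else 0 := by
          refine Finset.sum_le_sum fun i _ => ?_
          by_cases hi : cl i = j
          · rw [if_neg, if_neg (not_not.2 hi), mul_zero]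
            exact fun h' => h'.1 ((covered_snoc _ _ _ _).2 (Or.inl hi))
          · rw [if_pos hi]
            refine mul_le_mul_of_nonneg_left ?_ ENNReal.toReal_nonneg
            split_ifs
            exacts [clusterCost_snoc_le x cl ht h i j, clusterCost_nonneg _ _ _ _]
      _ = (∑ i with ¬ cl i = j, (q t h i).toReal) * clusterCost x cl h j := by
          rw [Finset.sum_mul, Finset.sum_filter]
      _ ≤ _ := mul_le_mul_of_nonneg_right hmiss (clusterCost_nonneg _ _ _ _)
  -- Covered clusters stay covered and costs only decrease, so no cluster newly enters the excess.
  · rw [if_neg hj, mul_zero]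
    refine (Finset.sum_eq_zero fun i _ => ?_).le
    rw [if_neg, mul_zero]
    rintro ⟨h1, h2⟩
    refine hj ⟨fun h3 => h1 ((covered_snoc _ _ _ _).2 (Or.inr h3)), h2.trans_le ?_⟩
    exact clusterCost_snoc_le x cl ht h i j

/-- Costs never increase, so the initial bound `Φ` stays valid and every choice contracts the excess
by the same factor. -/
theorem IsNoisy.future_maxUncovered_le [Fintype J] (hq : IsNoisy x ε₁ ε₂ q) (hε₁ : ε₁ < 1)
    (cl : ι → J) {y Φ : ℝ} (hy : 0 ≤ y) (r : ℕ) :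
    ∀ {t : ℕ}, t ≠ 0 → ∀ {h : Fin t → ι}, cost x (centers x h) ≤ Φ →
      future q (fun _ => maxUncovered x cl) r t h ≤
        y + Real.exp (-((1 - ε₁) * (y / Φ))) ^ r * excess x cl y h := by
  induction r with
  | zero =>
    intro t _ h _
    simpa only [future, pow_zero, one_mul] using maxUncovered_le_add_excess x cl hy h
  | succ r ih =>
    intro t ht h hΦ
    set ρ := Real.exp (-((1 - ε₁) * (y / Φ)))
    have hρ : 0 ≤ ρ ^ r := by positivity
    calc future q (fun _ => maxUncovered x cl) (r + 1) t h
        ≤ ∑ i, (q t h i).toReal * (y + ρ ^ r * excess x cl y (Fin.snoc h i : Fin (t + 1) → ι)) :=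
          Finset.sum_le_sum fun i _ => mul_le_mul_of_nonneg_left
            (ih t.succ_ne_zero ((cost_snoc_le x ht h i).trans hΦ)) ENNReal.toReal_nonneg
      _ = y + ρ ^ r * step q (excess x cl y) h := by
          simp only [mul_add, Finset.sum_add_distrib, ← Finset.sum_mul, sum_toReal_pmf, one_mul,
            step, Finset.mul_sum]
          congr 1
          exact Finset.sum_congr rfl fun i _ => by ring
      _ ≤ y + ρ ^ r * (ρ * excess x cl y h) := by
          have := mul_le_mul_of_nonneg_left (hq.step_excess_le hε₁ cl ht hy hΦ) hρ
          linarith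
      _ = _ := by rw [pow_succ, mul_assoc]

/-- The factor by which the largest cost of an uncovered cluster is expected to be smaller than the
current cost after `r` further choices. -/
noncomputable def decay (ε₁ : ℝ) (k r : ℕ) : ℝ :=
  if r = 0 then 1 else Real.log k / ((1 - ε₁) * r) + 1 / k

theorem decay_nonneg (hε₁ : ε₁ < 1) (k r : ℕ) : 0 ≤ decay ε₁ k r := by
  have hε₁' : 0 < 1 - ε₁ := sub_pos.2 hε₁
  unfold decay
  split_ifs
  · norm_num
  · have := Real.log_natCast_nonneg k
    positivity

theorem IsNoisy.future_maxUncovered_le_decay [Fintype J] (hq : IsNoisy x ε₁ ε₂ q) (hε₁ : ε₁ < 1)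
    (cl : ι → J) {k : ℕ} (hk : 0 < k) (r : ℕ) (ht : t ≠ 0) (h : Fin t → ι) :
    future q (fun _ => maxUncovered x cl) r t h ≤ decay ε₁ k r * cost x (centers x h) := by
  have hε₁' : 0 < 1 - ε₁ := sub_pos.2 hε₁
  rcases eq_or_ne r 0 with rfl | hr
  · simpa [future, decay] using maxUncovered_le_cost x cl h
  · set Φ := cost x (centers x h)
    have hr' : (0 : ℝ) < r := by exact_mod_cast Nat.pos_of_ne_zero hr
    have hk' : (0 : ℝ) < k := by exact_mod_cast hk
    have hlog := Real.log_natCast_nonneg k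
    have hΦ0 : 0 ≤ Φ := cost_nonneg _ _
    have hE := excess_le_cost x cl (Φ * Real.log k / ((1 - ε₁) * r)) h
    -- This `y` makes the contraction over `r` choices exactly `1 / k` when `Φ > 0`.
    have := hq.future_maxUncovered_le hε₁ cl (y := Φ * Real.log k / ((1 - ε₁) * r)) (Φ := Φ)
      (by positivity) r ht (h := h) le_rfl
    refine this.trans ?_
    rcases hΦ0.eq_or_lt with h0 | hpos
    · calc _ ≤ Φ * Real.log k / ((1 - ε₁) * r) +
            Real.exp (-((1 - ε₁) * (Φ * Real.log k / ((1 - ε₁) * r) / Φ))) ^ r * Φ := by gcongr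
        _ = decay ε₁ k r * Φ := by simp [← h0]
    · have hexp : Real.exp (-((1 - ε₁) * (Φ * Real.log k / ((1 - ε₁) * r) / Φ))) ^ r = 1 / k := by
        rw [← Real.exp_nat_mul, show (r : ℝ) * -((1 - ε₁) * (Φ * Real.log k / ((1 - ε₁) * r) / Φ)) =
          -Real.log k by field_simp, Real.exp_neg, Real.exp_log hk', one_div]
      rw [hexp, decay, if_neg hr]
      calc _ ≤ Φ * Real.log k / ((1 - ε₁) * r) + 1 / k * Φ := by gcongr
        _ = _ := by ring

open scoped Classical in
/-- The expected increase of the wasted choices, weighted by the future cost that they cause. -/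
theorem IsNoisy.sum_covered_future_le [Fintype J] (hq : IsNoisy x ε₁ ε₂ q) (hε₁ : ε₁ < 1)
    (hε₂ : 0 ≤ ε₂) (cl : ι → J) {k : ℕ} (hk : 0 < k) (r : ℕ) (h : Fin t → ι) :
    ∑ i with Covered cl h (cl i), (q t h i).toReal *
        future q (fun _ => maxUncovered x cl) r (t + 1) (Fin.snoc h i) ≤
      (1 + ε₂) * decay ε₁ k r * coveredCost x cl h := by
  have hβ := decay_nonneg hε₁ k r
  have hcc := coveredCost_nonneg x cl h
  rcases eq_or_ne t 0 with rfl | ht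
  · rw [Finset.filter_false_of_mem fun i _ hi => hi.ne_zero rfl, Finset.sum_empty]
    positivity
  set Φ := cost x (centers x h) with hΦ
  have hΦ0 : 0 ≤ Φ := cost_nonneg _ _
  -- Bounding by the cost before the choice makes the estimate independent of `i`, so the
  -- probability of waste factors out and its denominator `Φ` cancels.
  have hG : ∀ i, future q (fun _ => maxUncovered x cl) r (t + 1) (Fin.snoc h i) ≤
      decay ε₁ k r * Φ := fun i =>
    (hq.future_maxUncovered_le_decay hε₁ cl hk r t.succ_ne_zero _).trans
      (mul_le_mul_of_nonneg_left (cost_snoc_le x ht h i) hβ)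
  calc _ ≤ ∑ i with Covered cl h (cl i), (q t h i).toReal * (decay ε₁ k r * Φ) :=
        Finset.sum_le_sum fun i _ => mul_le_mul_of_nonneg_left (hG i) ENNReal.toReal_nonneg
    _ = (∑ i with Covered cl h (cl i), (q t h i).toReal) * (decay ε₁ k r * Φ) :=
        (Finset.sum_mul _ _ _).symm
    _ ≤ _ := ?_
  rcases hΦ0.eq_or_lt with h0 | hpos
  · rw [← h0, mul_zero, mul_zero]
    positivity
  · have hsum : ∑ i with Covered cl h (cl i), sqDist (x i) (centers x h) = coveredCost x cl h := by
      rw [coveredCost, ← Finset.sum_fiberwise_of_maps_to (g := cl)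
        (t := {j | Covered cl h j}) (fun i hi => by simpa using hi)]
      refine Finset.sum_congr rfl fun j hj => ?_
      refine Finset.sum_congr ?_ fun _ _ => rfl
      ext i
      simp only [Finset.mem_filter, Finset.mem_univ, true_and] at hj ⊢
      exact ⟨fun hi => hi.2, fun hi => ⟨hi ▸ hj, hi⟩⟩
    have := hq.sum_le ht hpos ({i | Covered cl h (cl i)} : Finset ι)
    rw [hsum] at this
    calc _ ≤ (1 + ε₂) * (coveredCost x cl h / Φ) * (decay ε₁ k r * Φ) :=
          mul_le_mul_of_nonneg_right this (by positivity)
      _ = _ := by field_simp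

/-- The expected cost of the clusters that stay uncovered because of the wasted choices. -/
theorem IsNoisy.expect_wasted_mul_le [Fintype J] (hq : IsNoisy x ε₁ ε₂ q) (hε₁ : ε₁ < 1)
    (hε₂ : 0 ≤ ε₂) (cl : ι → J) (c : J → Pt d) {k : ℕ} (hk : 0 < k) (t : ℕ) :
    ∀ r, expect q t (fun h => wasted cl h * future q (fun _ => maxUncovered x cl) r t h) ≤
      (1 + ε₂) * (16 * ((1 + ε₂) / (1 - ε₁)) * ∑ i, ‖x i - c (cl i)‖ ^ 2) *
        ∑ s ∈ Finset.range t, decay ε₁ k (r + s) := by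
  classical
  induction t with
  | zero => intro r; simp [expect_zero, wasted_zero]
  | succ t ih =>
    intro r
    have hstep : ∀ h : Fin t → ι, step q (fun h => wasted cl h *
        future q (fun _ => maxUncovered x cl) r (t + 1) h) h ≤
        wasted cl h * future q (fun _ => maxUncovered x cl) (r + 1) t h +
          (1 + ε₂) * decay ε₁ k r * coveredCost x cl h := by
      intro h
      refine le_trans (le_of_eq ?_)
        (add_le_add_right (hq.sum_covered_future_le hε₁ hε₂ cl hk r h) _)
      simp only [future]
      rw [Finset.sum_filter, step, step, Finset.mul_sum, ← Finset.sum_add_distrib]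
      refine Finset.sum_congr rfl fun i _ => ?_
      rw [wasted_snoc]
      split_ifs <;> ring
    have hβ := decay_nonneg hε₁ k r
    rw [expect_succ]
    refine (expect_mono q hstep).trans ?_
    -- The term `s = 0` pays for the last choice; the others are the induction hypothesis at `r +
    -- 1`.
    rw [expect_add, expect_const_mul, Finset.sum_range_succ', mul_add]
    refine add_le_add ((ih (r + 1)).trans_eq ?_) ?_
    · simp only [add_assoc, add_comm 1]
    · refine (mul_le_mul_of_nonneg_left (hq.expect_coveredCost_le hε₁ hε₂ cl c t)
        (by positivity)).trans_eq ?_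
      rw [add_zero]
      ring

theorem sum_decay_le (hε₁ : ε₁ < 1) (k : ℕ) :
    ∑ s ∈ Finset.range k, decay ε₁ k s ≤
      2 + Real.log k * (1 + Real.log k) / (1 - ε₁) := by
  have hε₁' : 0 < 1 - ε₁ := sub_pos.2 hε₁
  have hlog := Real.log_natCast_nonneg k
  have key : ∀ s, decay ε₁ k s ≤
      (if s = 0 then 1 else 0) + 1 / k + Real.log k / (1 - ε₁) * (s : ℝ)⁻¹ := by
    intro s
    unfold decay
    split_ifs with hs
    · have : (0 : ℝ) ≤ 1 / k := by positivity
      simp [hs]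
    · rw [div_mul_eq_div_div, div_eq_mul_inv (Real.log k / (1 - ε₁))]
      linarith
  have hharm : ∑ s ∈ Finset.range k, (s : ℝ)⁻¹ ≤ 1 + Real.log k := by
    rcases k.eq_zero_or_pos with rfl | hk
    · simp
    refine le_trans ?_ (harmonic_le_one_add_log k)
    rw [harmonic]
    push_cast
    calc ∑ s ∈ Finset.range k, (s : ℝ)⁻¹ ≤ ∑ s ∈ Finset.range (k + 1), (s : ℝ)⁻¹ :=
          Finset.sum_le_sum_of_subset_of_nonneg (Finset.range_mono k.le_succ)
            fun _ _ _ => by positivity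
      _ = _ := by rw [Finset.sum_range_succ']; simp
  refine (Finset.sum_le_sum fun s _ => key s).trans ?_
  rw [Finset.sum_add_distrib, Finset.sum_add_distrib, ← Finset.mul_sum]
  have h1 : ∑ s ∈ Finset.range k, (if s = 0 then (1 : ℝ) else 0) ≤ 1 := by
    rw [Finset.sum_ite_eq']
    split_ifs <;> norm_num
  have h2 : ∑ s ∈ Finset.range k, (1 / k : ℝ) ≤ 1 := by
    rw [Finset.sum_const, Finset.card_range, nsmul_eq_mul, mul_one_div]
    exact div_self_le_one _
  have h3 := mul_le_mul_of_nonneg_left hharm (div_nonneg hlog hε₁'.le)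
  calc _ ≤ 1 + 1 + Real.log k / (1 - ε₁) * (1 + Real.log k) := add_le_add (add_le_add h1 h2) h3
    _ = _ := by ring

end Future

/-! ### The approximation guarantee -/

/-- Neither the centers nor the assignment need be optimal, so the infimum defining `opt` need not
be attained. -/
theorem IsNoisy.expectedCost_le_of_assignment {x : ι → Pt d} {ε₁ ε₂ : ℝ} {q : Strategy ι}
    [Fintype J] [Nonempty J] (hq : IsNoisy x ε₁ ε₂ q) (hε₁ : ε₁ < 1) (hε₂ : 0 ≤ ε₂) (cl : ι → J)
    (c : J → Pt d) :
    expectedCost x q (Fintype.card J) ≤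
      16 * ((1 + ε₂) / (1 - ε₁)) * (∑ i, ‖x i - c (cl i)‖ ^ 2) *
        (1 + (1 + ε₂) * (2 + Real.log (Fintype.card J) * (1 + Real.log (Fintype.card J)) /
          (1 - ε₁))) := by
  have hε₁' : 0 < 1 - ε₁ := sub_pos.2 hε₁
  set k := Fintype.card J
  set S := 16 * ((1 + ε₂) / (1 - ε₁)) * ∑ i, ‖x i - c (cl i)‖ ^ 2 with hS
  have hS0 : 0 ≤ S := by positivity
  calc expectedCost x q k
      ≤ expect q k (fun h => coveredCost x cl h + wasted cl h * maxUncovered x cl h) :=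
        expect_mono q fun h => cost_le_coveredCost_add x cl h
    _ = expect q k (coveredCost x cl) +
          expect q k (fun h => wasted cl h * future q (fun _ => maxUncovered x cl) 0 k h) :=
        expect_add q _ _
    _ ≤ S + (1 + ε₂) * S * ∑ s ∈ Finset.range k, decay ε₁ k (0 + s) :=
        add_le_add (hq.expect_coveredCost_le hε₁ hε₂ cl c k)
          (hq.expect_wasted_mul_le hε₁ hε₂ cl c Fintype.card_pos k 0)
    _ ≤ S + (1 + ε₂) * S * (2 + Real.log k * (1 + Real.log k) / (1 - ε₁)) := by
        simp only [zero_add]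
        gcongr
        exact sum_decay_le hε₁ k
    _ = _ := by ring

theorem one_le_noise_ratio {ε₁ ε₂ : ℝ} (h0 : 0 ≤ ε₁) (hε₁ : ε₁ < 1) (hε₂ : 0 ≤ ε₂) :
    1 ≤ (1 + ε₂) / (1 - ε₁) := by
  rw [one_le_div (sub_pos.2 hε₁)]
  linarith

theorem two_thirds_le_log {k : ℕ} (hk : 2 ≤ k) : 2 / 3 ≤ Real.log k := by
  have h1 : Real.log 2 ≤ Real.log k := Real.log_le_log (by norm_num) (by exact_mod_cast hk)
  linarith [Real.log_two_gt_d9]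

/-- A center set realizes its cost by an assignment of the data points to the centers. -/
theorem exists_assignment (x : ι → Pt d) {C : Finset (Pt d)} (hC : C.Nonempty) :
    ∃ cl : ι → C, ∑ i, ‖x i - (cl i : Pt d)‖ ^ 2 = cost x (C : Set (Pt d)) := by
  have := hC.to_subtype
  have h : ∀ i, ∃ c : C, ‖x i - (c : Pt d)‖ ^ 2 = sqDist (x i) (C : Set (Pt d)) := fun i =>
    exists_eq_ciInf_of_finite (f := fun c : C => ‖x i - (c : Pt d)‖ ^ 2)
  choose cl hcl using h
  exact ⟨cl, Finset.sum_congr rfl fun i _ => hcl i⟩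

theorem IsNoisy.expectedCost_le_cost {x : ι → Pt d} {ε₁ ε₂ : ℝ} {q : Strategy ι}
    (hq : IsNoisy x ε₁ ε₂ q) (h0 : 0 ≤ ε₁) (hε₁ : ε₁ < 1) (hε₂ : 0 ≤ ε₂) {C : Finset (Pt d)}
    (hC : 2 ≤ C.card) :
    expectedCost x q C.card ≤
      160 * (((1 + ε₂) / (1 - ε₁)) ^ 2 * Real.log C.card ^ 2 * cost x (C : Set (Pt d))) := by
  have hne : C.Nonempty := Finset.card_pos.1 (by omega)
  have := hne.to_subtype
  obtain ⟨cl, hcl⟩ := exists_assignment x hne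
  have h := hq.expectedCost_le_of_assignment hε₁ hε₂ cl (fun c => (c : Pt d))
  rw [hcl, Fintype.card_coe] at h
  refine h.trans ?_
  have hε₁' : 0 < 1 - ε₁ := sub_pos.2 hε₁
  have hR := one_le_noise_ratio h0 hε₁ hε₂
  have hL := two_thirds_le_log hC
  have hcost := cost_nonneg x (C : Set (Pt d))
  have hεR : 1 + ε₂ ≤ (1 + ε₂) / (1 - ε₁) := le_div_self (by linarith) hε₁' (by linarith)
  set R := (1 + ε₂) / (1 - ε₁)
  set L := Real.log C.card
  have key : 1 + (1 + ε₂) * (2 + L * (1 + L) / (1 - ε₁)) ≤ 10 * (R * L ^ 2) := by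
    have e : (1 + ε₂) * (2 + L * (1 + L) / (1 - ε₁)) = 2 * (1 + ε₂) + R * (L + L ^ 2) := by
      simp only [R]; field_simp
    -- `L ≥ 2/3` gives `9 L² ≥ L + 3`; with `16` from the covered clusters this yields `160`.
    have hb : 1 + 2 + (L + L ^ 2) ≤ 10 * L ^ 2 := by nlinarith
    rw [e]
    nlinarith
  calc 16 * R * cost x (C : Set (Pt d)) * (1 + (1 + ε₂) * (2 + L * (1 + L) / (1 - ε₁)))
      ≤ 16 * R * cost x (C : Set (Pt d)) * (10 * (R * L ^ 2)) := by gcongr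
    _ = _ := by ring

/-- In dimension at least one there are center sets of any size. -/
theorem nonempty_centerSets [NeZero d] (k : ℕ) :
    Nonempty {C : Finset (Pt d) // C.card = k} := by
  have : Infinite (Pt d) := Module.Free.infinite ℝ (Pt d)
  obtain ⟨C, hC⟩ := Infinite.exists_subset_card_eq (Pt d) k
  exact ⟨⟨C, hC⟩⟩

theorem IsNoisy.expectedCost_le_opt {x : ι → Pt d} {ε₁ ε₂ : ℝ} {q : Strategy ι}
    (hq : IsNoisy x ε₁ ε₂ q) (h0 : 0 ≤ ε₁) (hε₁ : ε₁ < 1) (hε₂ : 0 ≤ ε₂) {k : ℕ} (hk : 2 ≤ k) :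
    expectedCost x q k ≤
      160 * (((1 + ε₂) / (1 - ε₁)) ^ 2 * Real.log k ^ 2 * opt x k) := by
  have hR := one_le_noise_ratio h0 hε₁ hε₂
  have hL := two_thirds_le_log hk
  rcases eq_or_ne d 0 with rfl | hd
  -- In dimension zero no set of `k ≥ 2` points exists and `opt` is an empty infimum; all data
  -- points coincide, so the cost is zero.
  · have hcost : ∀ c : Fin k → ι, cost x (centers x c) = 0 := fun c => by
      refine Finset.sum_eq_zero fun i _ => le_antisymm ?_ (sqDist_nonneg _ _)
      refine (sqDist_le (C := centers x c) (x i) (c := x (c ⟨0, by omega⟩))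
        (Set.mem_range_self (f := fun s => x (c s)) _)).trans_eq ?_
      rw [Subsingleton.elim (x i) (x (c ⟨0, by omega⟩)), sub_self, norm_zero]
      norm_num
    have hopt : 0 ≤ opt x k := Real.iInf_nonneg fun C => cost_nonneg _ _
    simp only [expectedCost, hcost, mul_zero, Finset.sum_const_zero]
    positivity
  · have : NeZero d := ⟨hd⟩
    have := nonempty_centerSets (d := d) k
    have hB : 0 < 160 * (((1 + ε₂) / (1 - ε₁)) ^ 2 * Real.log k ^ 2) := by positivity
    rw [← mul_assoc, ← div_le_iff₀' hB]
    refine le_ciInf ?_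
    rintro ⟨C, rfl⟩
    rw [div_le_iff₀' hB, mul_assoc]
    exact hq.expectedCost_le_cost h0 hε₁ hε₂ hk

/-- Few centers relative to the noise: `log k` is controlled by the noise ratio. -/
theorem log_le_of_div_log_le_threshold {ε₁ ε₂ : ℝ} (h0 : 0 ≤ ε₁) (hε₁ : ε₁ < 1) (hε₂ : 0 ≤ ε₂)
    {k : ℕ} (hk : 2 ≤ k) (h : (k : ℝ) / Real.log k ≤ threshold ε₁ ε₂) :
    Real.log k ≤ 13 * max 1 (Real.log ((1 + ε₂) / (1 - ε₁))) := by
  have hε₁' : 0 < 1 - ε₁ := sub_pos.2 hε₁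
  have hR := one_le_noise_ratio h0 hε₁ hε₂
  have hL := two_thirds_le_log hk
  have hthr : threshold ε₁ ε₂ ≤ 24 * ((1 + ε₂) / (1 - ε₁)) ^ 2 := by
    refine max_le (by nlinarith) ?_
    rw [div_pow, mul_div_assoc']
    have : (ε₁ + ε₂) * (1 + ε₂) ≤ (1 + ε₂) * (1 + ε₂) := by gcongr
    refine div_le_div_of_nonneg_right ?_ (by positivity)
    linarith
  set R := (1 + ε₂) / (1 - ε₁)
  have hk0 : (0 : ℝ) < k := by positivity
  have hsq : 0 < √(k : ℝ) := Real.sqrt_pos.2 hk0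
  have hlog2 : Real.log k = 2 * Real.log √(k : ℝ) := by rw [Real.log_sqrt hk0.le]; ring
  have hlog : Real.log k ≤ 2 * √(k : ℝ) := by
    linarith [Real.log_le_sub_one_of_pos hsq]
  -- `k ≤ 24 R² ln k ≤ 48 R² √k`. Taking logarithms, `ln k ≤ 2 (9/2 + 2 ln R) = 9 + 4 ln R`, whence
  -- `13 = 9 + 4`.
  have hsqrt : √(k : ℝ) ≤ 48 * R ^ 2 := by
    have h1 : (k : ℝ) ≤ 24 * R ^ 2 * Real.log k :=
      (div_le_iff₀ (by linarith)).1 (h.trans hthr)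
    have h2 : √(k : ℝ) * √(k : ℝ) ≤ 48 * R ^ 2 * √(k : ℝ) := by
      rw [Real.mul_self_sqrt hk0.le]
      nlinarith [mul_le_mul_of_nonneg_left hlog (by positivity : 0 ≤ 24 * R ^ 2)]
    exact le_of_mul_le_mul_right h2 hsq
  have h3 : Real.log √(k : ℝ) ≤ Real.log 48 + 2 * Real.log R := by
    refine (Real.log_le_log hsq hsqrt).trans_eq ?_
    rw [Real.log_mul (by norm_num) (by positivity), Real.log_pow]
    norm_num
  have h4 : Real.log 48 ≤ 9 / 2 := by
    have : Real.log 48 ≤ Real.log (2 ^ 6) := Real.log_le_log (by norm_num) (by norm_num)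
    rw [Real.log_pow] at this
    push_cast at this
    linarith [Real.log_two_lt_d9]
  have h5 := le_max_left 1 (Real.log R)
  have h6 := le_max_right 1 (Real.log R)
  linarith

end NoisyKMeans

theorem theorem2 :
    ∃ A : ℝ, 0 < A ∧
      ∀ (d n k : ℕ) (_ : 0 < n) (_ : 2 ≤ k) (x : Fin n → NoisyKMeans.Pt d)
        (ε₁ ε₂ : ℝ) (_ : 0 ≤ ε₁) (_ : ε₁ < 1) (_ : 0 ≤ ε₂)
        (q : NoisyKMeans.Strategy (Fin n)) (_ : NoisyKMeans.IsNoisy x ε₁ ε₂ q),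
        (NoisyKMeans.threshold ε₁ ε₂ ≤ (k : ℝ) / Real.log k →
          NoisyKMeans.expectedCost x q k ≤
            A * (((1 + ε₂) / (1 - ε₁)) ^ 3 * Real.log k ^ 2 * NoisyKMeans.opt x k)) ∧
        ((k : ℝ) / Real.log k ≤ NoisyKMeans.threshold ε₁ ε₂ →
          NoisyKMeans.expectedCost x q k ≤
            A * (((1 + ε₂) / (1 - ε₁)) ^ 4 *
              max 1 (Real.log ((1 + ε₂) / (1 - ε₁))) ^ 2 * NoisyKMeans.opt x k)) := by
  -- The factor `13 ^ 2` is needed only in the second regime, where `ln² k` is replaced.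
  refine ⟨160 * 13 ^ 2, by norm_num, fun d n k _ hk x ε₁ ε₂ h0 hε₁ hε₂ q hq => ?_⟩
  have h := hq.expectedCost_le_opt h0 hε₁ hε₂ hk
  have hR := NoisyKMeans.one_le_noise_ratio h0 hε₁ hε₂
  have hL := NoisyKMeans.two_thirds_le_log hk
  have hopt : 0 ≤ NoisyKMeans.opt x k :=
    Real.iInf_nonneg fun C => NoisyKMeans.cost_nonneg _ _
  refine ⟨fun _ => h.trans ?_, fun hthr => h.trans ?_⟩
  · gcongr ?_ * (?_ * _ * _)
    · norm_num
    · exact pow_le_pow_right₀ hR (by norm_num)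
  · have hlog := NoisyKMeans.log_le_of_div_log_le_threshold h0 hε₁ hε₂ hk hthr
    calc _ ≤ 160 * (((1 + ε₂) / (1 - ε₁)) ^ 4 *
          (13 * max 1 (Real.log ((1 + ε₂) / (1 - ε₁)))) ^ 2 * NoisyKMeans.opt x k) := by
          gcongr <;> norm_num [hR]
      _ = _ := by ring
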